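/- Let $n\ge 1$ and let $X_1,\dots,X_n$ be independent random variables, each uniformly distributed on $[0,1]$, and let $\mathcal F_i=\sigma\{X_1,\dots,X_i\}$. A selection policy $\pi$ makes sequential selections at stopping times $\tau_1<\tau_2<\cdots$ with respect to $(\mathcal F_i)_{1\le i\le n}$, with values in $\{1,\dots,n\}\cup\{\infty\}$ (strictly increasing as long as they are finite; once $\tau_j=\infty$ no further selection is made), such that the selected values satisfy $X_{\tau_1}\le X_{\tau_2}\le\cdots$. Its length $L_n(\pi)$ is the largest $k\ge 0$ such that $\tau_1<\cdots<\tau_k\le n$ and $X_{\tau_1}<X_{\tau_2}<\cdots<X_{\tau_k}$. Let $$\ell(n)=\max_{\pi}\mathbb E[L_n(\pi)],$$ where the maximum is over all selection policies. Then this maximum is attained, and $$\ell(n)\le\sqrt{2n}.$$ -/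

import Mathlib

open MeasureTheory ProbabilityTheory

namespace OnlineSelection

variable {Ω : Type*} [MeasurableSpace Ω] {n : ℕ}

/-- A policy for the selection of a monotone subsequence from `X 0, …, X (n - 1)`: the `j`-th
selection is made at the stopping time `τ j` (for the filtration generated by the observations),
and `τ j ω = ⊤` means that at most `j` selections are made (`j = 0, 1, 2, …`). The selection times
increase strictly and the selected values increase weakly. -/
structure SelectionPolicy (X : Fin n → Ω → ℝ) (hX : ∀ i, Measurable (X i)) where
  τ : ℕ → Ω → WithTop (Fin n)
  isStoppingTime : ∀ j, IsStoppingTime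
    (Filtration.natural X fun i => (hX i).stronglyMeasurable) (τ j)
  lt_succ : ∀ j ω, τ j ω ≠ ⊤ → τ j ω < τ (j + 1) ω
  succ_eq_top : ∀ j ω, τ j ω = ⊤ → τ (j + 1) ω = ⊤
  le_succ : ∀ j ω (a b : Fin n), τ j ω = a → τ (j + 1) ω = b → X a ω ≤ X b ω

namespace SelectionPolicy

variable {X : Fin n → Ω → ℝ} {hX : ∀ i, Measurable (X i)}

/-- The first `k` selections are made, at times `i 0 < ⋯ < i (k - 1)`, and the selected values
are strictly increasing. -/
def SelectsIncreasing (π : SelectionPolicy X hX) (ω : Ω) (k : ℕ) : Prop :=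
  ∃ i : Fin k → Fin n, (∀ j : Fin k, π.τ j ω = i j) ∧ StrictMono i ∧
    StrictMono fun j => X (i j) ω

/-- The length of the strictly increasing subsequence selected by `π`: the largest `k` for which
the first `k` selections are made and have strictly increasing values. -/
noncomputable def length (π : SelectionPolicy X hX) (ω : Ω) : ℕ :=
  sSup {k : ℕ | π.SelectsIncreasing ω k}

theorem SelectsIncreasing.le {π : SelectionPolicy X hX} {ω : Ω} {k : ℕ}
    (h : π.SelectsIncreasing ω k) : k ≤ n := by
  obtain ⟨i, -, hi, -⟩ := h
  simpa using Fintype.card_le_of_injective i hi.injective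

/-- The supremum in the definition of the length is a maximum. -/
theorem isGreatest_length (π : SelectionPolicy X hX) (ω : Ω) :
    IsGreatest {k : ℕ | π.SelectsIncreasing ω k} (π.length ω) := by
  have hb : BddAbove {k : ℕ | π.SelectsIncreasing ω k} := ⟨n, fun _ hk => hk.le⟩
  have h0 : π.SelectsIncreasing ω 0 :=
    ⟨fun j => j.elim0, fun j => j.elim0, fun j => j.elim0, fun j => j.elim0⟩
  exact ⟨Nat.sSup_mem ⟨0, h0⟩ hb, fun k hk => le_csSup hb hk⟩

theorem length_le (π : SelectionPolicy X hX) (ω : Ω) : π.length ω ≤ n :=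
  (π.isGreatest_length ω).1.le

theorem measurable_length (π : SelectionPolicy X hX) : Measurable π.length := by
  have hτ : ∀ j (a : Fin n), MeasurableSet {ω | π.τ j ω = a} := fun j a =>
    (Filtration.natural X fun i => (hX i).stronglyMeasurable).le a _
      ((π.isStoppingTime j).measurableSet_eq a)
  have hS : ∀ k, MeasurableSet {ω | π.SelectsIncreasing ω k} := by
    intro k
    have : {ω | π.SelectsIncreasing ω k} = ⋃ i : Fin k → Fin n,
        (⋂ j : Fin k, {ω | π.τ j ω = i j}) ∩ ({_ω | StrictMono i} ∩
          ⋂ a, ⋂ b, ⋂ _ : a < b, {ω | X (i a) ω < X (i b) ω}) := by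
      ext ω
      simp [SelectsIncreasing, StrictMono]
    rw [this]
    refine MeasurableSet.iUnion fun i => (MeasurableSet.iInter fun j : Fin k => hτ j (i j)).inter
      ((MeasurableSet.const _).inter (MeasurableSet.iInter fun a => MeasurableSet.iInter fun b =>
        MeasurableSet.iInter fun _ => measurableSet_lt (hX _) (hX _)))
  refine measurable_to_countable' fun k => ?_
  have : π.length ⁻¹' {k} = {ω | π.SelectsIncreasing ω k} ∩
      ⋂ m, ⋂ _ : k < m, {ω | π.SelectsIncreasing ω m}ᶜ := by
    ext ω
    simp only [Set.mem_preimage, Set.mem_singleton_iff, Set.mem_inter_iff, Set.mem_ofPred_eq,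
      Set.mem_iInter, Set.mem_compl_iff]
    constructor
    · rintro rfl
      exact ⟨(π.isGreatest_length ω).1, fun m hm h => hm.not_ge ((π.isGreatest_length ω).2 h)⟩
    · rintro ⟨h, h'⟩
      refine (π.isGreatest_length ω).unique ⟨h, fun m hm => ?_⟩
      by_contra hlt
      exact h' m (not_le.mp hlt) hm
  rw [this]
  exact (hS k).inter (MeasurableSet.iInter fun m => MeasurableSet.iInter fun _ => (hS m).compl)

theorem integrable_length (π : SelectionPolicy X hX) (μ : Measure Ω) [IsFiniteMeasure μ] :
    Integrable (fun ω => (π.length ω : ℝ)) μ := by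
  refine Integrable.of_bound
    (measurable_from_top.comp π.measurable_length).aestronglyMeasurable (n : ℝ) ?_
  exact Filter.Eventually.of_forall fun ω => by
    simpa using π.length_le ω

/-- The expected length of the selected increasing subsequence. -/
noncomputable def expectedLength (π : SelectionPolicy X hX) (μ : Measure Ω) : ℝ :=
  ∫ ω, (π.length ω : ℝ) ∂μ

end SelectionPolicy

/-- The optimal expected length `ℓ(n)` for the observations `X 0, …, X (n - 1)`. -/
noncomputable def optimalLength (μ : Measure Ω) (X : Fin n → Ω → ℝ)
    (hX : ∀ i, Measurable (X i)) : ℝ :=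
  sSup (Set.range fun π : SelectionPolicy X hX => π.expectedLength μ)

end OnlineSelection

/-! Dynamic programming. The state is the last selected value `x` together with the number `k` of
observations still to come, and `value k x` solves the Bellman recursion, in which a fresh uniform
`u > x` may be taken for reward `1 + value (k - 1) u` or declined for `value (k - 1) x`.

For any policy, selections made so far plus `value` at the current state (`potential`) has
nonincreasing mean, because the next observation is uniform and independent of the state. It starts
at `value n 0` and ends at the number of selections, so `value n 0` bounds every expected length
(`integral_selCount_le_value`). A rule that always takes the better branch keeps the mean constant
(`integral_selCount_eq_value`), so the maximum is attained and equals `value n 0`.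

The bound comes from linear majorants: `value k x ≤ c * (1 - x) + k / (2 * c)` for every `c > 0`
(`value_le_linear`). At `x = 0`, `k = n` the right side is `c + n / (2 * c)`, whose minimum over `c`
is `√(2n)`. -/

namespace OnlineSelection

variable {Ω : Type*} [MeasurableSpace Ω] {n : ℕ}

/-! ### The value function and its square-root bound. -/

/-- The best of keeping the last selected value `m` and of moving to `u`, when the latter is
admissible. -/
noncomputable def stepReward (v : ℝ → ℝ) (m u : ℝ) : ℝ :=
  if m < u then max (v m) (1 + v u) else v m

/-- The optimal expected number of selections from `k` further observations when the last selected
value is `x`. -/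
noncomputable def value : ℕ → ℝ → ℝ
  | 0, _ => 0
  | k + 1, x => ∫ u in Set.Icc (0 : ℝ) 1, stepReward (value k) x u

theorem stepReward_nonneg {v : ℝ → ℝ} (hv : ∀ x, 0 ≤ v x) (m u : ℝ) : 0 ≤ stepReward v m u := by
  unfold stepReward
  split_ifs
  · exact le_max_of_le_left (hv m)
  · exact hv m

theorem stepReward_le {v : ℝ → ℝ} {C : ℝ} (hv : ∀ x, v x ≤ C) (m u : ℝ) :
    stepReward v m u ≤ C + 1 := by
  unfold stepReward
  have h1 := hv m
  have h2 := hv u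
  split_ifs
  · exact max_le (by linarith) (by linarith)
  · linarith

theorem measurable_stepReward {v : ℝ → ℝ} (hv : Measurable v) :
    Measurable fun p : ℝ × ℝ => stepReward v p.1 p.2 :=
  Measurable.ite (measurableSet_lt measurable_fst measurable_snd)
    ((hv.comp measurable_fst).max ((hv.comp measurable_snd).const_add 1)) (hv.comp measurable_fst)

instance : IsProbabilityMeasure (volume.restrict (Set.Icc (0 : ℝ) 1)) := ⟨by simp⟩

theorem measurable_value (k : ℕ) : Measurable (value k) := by
  induction k with
  | zero => exact measurable_const
  | succ k ih =>
    exact (measurable_stepReward ih).stronglyMeasurable.integral_prod_right'.measurable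

theorem value_nonneg (k : ℕ) (x : ℝ) : 0 ≤ value k x := by
  induction k generalizing x with
  | zero => exact le_rfl
  | succ k ih => exact integral_nonneg fun u => stepReward_nonneg ih x u

theorem integrable_stepReward {v : ℝ → ℝ} (hv : Measurable v) (hv0 : ∀ x, 0 ≤ v x) {C : ℝ}
    (hC : ∀ x, v x ≤ C) (x : ℝ) :
    Integrable (stepReward v x) (volume.restrict (Set.Icc (0 : ℝ) 1)) := by
  refine Integrable.of_bound
    ((measurable_stepReward hv).comp measurable_prodMk_left).aestronglyMeasurable (C + 1) ?_
  refine Filter.Eventually.of_forall fun u => ?_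
  rw [Real.norm_of_nonneg (stepReward_nonneg hv0 x u)]
  exact stepReward_le hC x u

theorem value_le (k : ℕ) (x : ℝ) : value k x ≤ k := by
  induction k generalizing x with
  | zero => simp [value]
  | succ k ih =>
    calc value (k + 1) x
        ≤ ∫ _ in Set.Icc (0 : ℝ) 1, ((k : ℝ) + 1) :=
          integral_mono (integrable_stepReward (measurable_value k) (value_nonneg k) ih x)
            (integrable_const _) fun u => stepReward_le ih x u
      _ = ((k + 1 : ℕ) : ℝ) := by simp

/-- Under the graph lies a right triangle of height `1` and base `1 / c`. -/
theorem integral_max_one_sub_le {c x : ℝ} (hc : 0 < c) :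
    ∫ u in Set.Icc (0 : ℝ) 1, (if x < u then max 0 (1 - c * (u - x)) else 0) ≤ 1 / (2 * c) := by
  have hle : x ≤ x + 1 / c := by
    have := (one_div_pos.2 hc).le
    linarith
  have heq : (fun u : ℝ => if x < u then max 0 (1 - c * (u - x)) else 0) =
      (Set.Ioc x (x + 1 / c)).indicator fun u => 1 - c * (u - x) := by
    ext u
    simp only [Set.indicator_apply, Set.mem_Ioc]
    by_cases hu : x < u
    · by_cases hu' : u ≤ x + 1 / c
      · have : c * (u - x) ≤ 1 := by
          rw [mul_comm, ← le_div_iff₀ hc]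
          linarith
        rw [if_pos hu, if_pos ⟨hu, hu'⟩, max_eq_right (by linarith)]
      · have : 1 < c * (u - x) := by
          rw [mul_comm, ← div_lt_iff₀ hc]
          linarith
        rw [if_pos hu, if_neg fun h => hu' h.2, max_eq_left (by linarith)]
    · rw [if_neg hu, if_neg fun h => hu h.1]
  have hcont : Continuous fun u : ℝ => 1 - c * (u - x) := by fun_prop
  have hint : Integrable (fun u : ℝ => if x < u then max 0 (1 - c * (u - x)) else 0) := by
    rw [heq, integrable_indicator_iff measurableSet_Ioc]
    exact (hcont.intervalIntegrable x (x + 1 / c)).1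
  have hnn : 0 ≤ᵐ[volume] fun u : ℝ => if x < u then max 0 (1 - c * (u - x)) else 0 :=
    Filter.Eventually.of_forall fun u => by
      dsimp only [Pi.zero_apply]
      split_ifs
      · exact le_max_left _ _
      · exact le_rfl
  -- Passing to the whole line avoids asking where `x` and `x + 1 / c` lie relative to `[0, 1]`.
  calc ∫ u in Set.Icc (0 : ℝ) 1, (if x < u then max 0 (1 - c * (u - x)) else 0)
      ≤ ∫ u : ℝ, (if x < u then max 0 (1 - c * (u - x)) else 0) :=
        setIntegral_le_integral hint hnn
    _ = ∫ u in x..(x + 1 / c), (1 - c * (u - x)) := by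
        rw [heq, integral_indicator measurableSet_Ioc, intervalIntegral.integral_of_le hle]
    _ = ∫ u in (0 : ℝ)..(1 / c), (1 - c * u) := by
        rw [intervalIntegral.integral_comp_sub_right (fun u => 1 - c * u) x]
        simp
    _ = 1 / (2 * c) := by
        have h1 : ∫ u in (0 : ℝ)..(1 / c), c * u = c * ((1 / c) ^ 2 / 2) := by
          rw [intervalIntegral.integral_const_mul, integral_id]
          simp
        rw [intervalIntegral.integral_sub (by simp)
          (Continuous.intervalIntegrable (by fun_prop) _ _), h1]
        simp only [intervalIntegral.integral_const, smul_eq_mul]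
        field_simp
        ring

/-- Against a linear majorant of slope `-c`, moving from `x` to `u` gains one selection and costs `c
* (u - x)`. One observation thus adds at most the mean of the positive part of `1 - c * (u - x)`,
which is at most `1 / (2 * c)`. -/
theorem value_le_linear {c : ℝ} (hc : 0 < c) (k : ℕ) {x : ℝ} (hx : x ≤ 1) :
    value k x ≤ c * (1 - x) + k * (1 / (2 * c)) := by
  induction k generalizing x with
  | zero =>
    have : 0 ≤ c * (1 - x) := mul_nonneg hc.le (by linarith)
    simpa [value] using this
  | succ k ih =>
    have hmeas : Measurable fun u : ℝ => if x < u then max 0 (1 - c * (u - x)) else 0 :=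
      Measurable.ite measurableSet_Ioi (by fun_prop) measurable_const
    have hint : Integrable (fun u : ℝ => if x < u then max 0 (1 - c * (u - x)) else 0)
        (volume.restrict (Set.Icc (0 : ℝ) 1)) := by
      refine Integrable.of_bound hmeas.aestronglyMeasurable 1
        (Filter.Eventually.of_forall fun u => ?_)
      split_ifs with h
      · have : 0 ≤ c * (u - x) := mul_nonneg hc.le (by linarith)
        rw [Real.norm_of_nonneg (le_max_left _ _)]
        exact max_le zero_le_one (by linarith)
      · simp
    calc value (k + 1) x
        ≤ ∫ u in Set.Icc (0 : ℝ) 1, ((c * (1 - x) + k * (1 / (2 * c))) +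
            if x < u then max 0 (1 - c * (u - x)) else 0) := by
          refine setIntegral_mono_on
            (integrable_stepReward (measurable_value k) (value_nonneg k) (value_le k) x)
            ((integrable_const _).add hint) measurableSet_Icc fun u hu => ?_
          unfold stepReward
          split_ifs with h
          · refine max_le ?_ ?_
            · have := ih hx
              have := le_max_left 0 (1 - c * (u - x))
              linarith
            · have := ih hu.2
              have := le_max_right 0 (1 - c * (u - x))
              linarith
          · simpa using ih hx
      _ ≤ (c * (1 - x) + k * (1 / (2 * c))) + 1 / (2 * c) := by
          rw [integral_add (integrable_const _) hint]
          simpa using integral_max_one_sub_le (x := x) hc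
      _ = c * (1 - x) + (k + 1 : ℕ) * (1 / (2 * c)) := by push_cast; ring

theorem value_zero_le_sqrt {k : ℕ} (hk : 1 ≤ k) : value k 0 ≤ √(2 * (k : ℝ)) := by
  have hk' : (0 : ℝ) < k := by exact_mod_cast hk
  have hs : 0 < √(2 * (k : ℝ)) := Real.sqrt_pos.2 (by linarith)
  have hsq : √(2 * (k : ℝ)) ^ 2 = 2 * k := Real.sq_sqrt (by linarith)
  -- The slope `√(2k) / 2` minimises `c + k / (2 * c)`, making both terms equal.
  have h := value_le_linear (half_pos hs) k zero_le_one
  generalize √(2 * (k : ℝ)) = s at hs hsq h ⊢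
  have : (k : ℝ) * (1 / (2 * (s / 2))) = s / 2 := by
    field_simp
    linarith
  rw [this] at h
  linarith

/-- Policies may select a value equal to the last one, so the upper bound needs the recursion with
`≤`; the two forms differ only at `u = x`. -/
theorem value_succ_eq_integral_le (k : ℕ) (x : ℝ) :
    value (k + 1) x = ∫ u in Set.Icc (0 : ℝ) 1,
      if x ≤ u then max (value k x) (1 + value k u) else value k x := by
  refine integral_congr_ae (ae_restrict_of_ae ?_)
  filter_upwards [Measure.ae_ne volume x] with u hu
  simp [stepReward, hu.symm.le_iff_lt]

/-! ### Information from the past and independence of the next observation. -/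

/-- The σ-algebra generated by the first `i` observations. -/
@[reducible]
def past (X : Fin n → Ω → ℝ) (i : ℕ) : MeasurableSpace Ω :=
  ⨆ j ∈ {j : Fin n | (j : ℕ) < i}, MeasurableSpace.comap (X j) inferInstance

/-- The observations as a sequence indexed by `ℕ`, continued by `0`. -/
def obs (X : Fin n → Ω → ℝ) (i : ℕ) (ω : Ω) : ℝ :=
  if h : i < n then X ⟨i, h⟩ ω else 0

omit [MeasurableSpace Ω] in
theorem past_mono (X : Fin n → Ω → ℝ) : Monotone (past X) := fun _ _ hij =>
  biSup_mono fun _ hk => lt_of_lt_of_le hk hij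

theorem past_le {X : Fin n → Ω → ℝ} (hX : ∀ i, Measurable (X i)) (i : ℕ) :
    past X i ≤ ‹MeasurableSpace Ω› :=
  iSup₂_le fun j _ => (hX j).comap_le

/-- The shift matters: the decision at index `i` may use `X i` and lives in `past X (i + 1)`, while
the state before it lives in `past X i` and is independent of `X i`. -/
theorem natural_eq_past {X : Fin n → Ω → ℝ} (hX : ∀ i, Measurable (X i)) (i : Fin n) :
    Filtration.natural X (fun i => (hX i).stronglyMeasurable) i = past X (i + 1) := by
  change ⨆ j ≤ i, MeasurableSpace.comap (X j) _ = ⨆ j ∈ {j : Fin n | (j : ℕ) < i + 1}, _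
  simp only [Set.mem_ofPred_eq, Nat.lt_succ_iff, Fin.le_def]

omit [MeasurableSpace Ω] in
theorem measurable_obs (X : Fin n → Ω → ℝ) (i : ℕ) : Measurable[past X (i + 1)] (obs X i) := by
  by_cases h : i < n
  · have : obs X i = X ⟨i, h⟩ := by
      ext ω
      simp [obs, h]
    rw [this]
    refine measurable_iff_comap_le.2 ?_
    exact le_iSup₂_of_le (⟨i, h⟩ : Fin n) (Nat.lt_succ_self i) le_rfl
  · have : obs X i = fun _ => 0 := by
      ext ω
      simp [obs, h]
    rw [this]
    exact measurable_const

theorem indepFun_of_past {μ : Measure Ω} {X : Fin n → Ω → ℝ} (hX : ∀ i, Measurable (X i))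
    (hindep : iIndepFun X μ) {M : Ω → ℝ} (i : Fin n) (hM : Measurable[past X i] M) :
    IndepFun M (X i) μ := by
  have hd : Disjoint {j : Fin n | (j : ℕ) < i} {i} := by simp
  have h := indep_iSup_of_disjoint (fun j => (hX j).comap_le) hindep.iIndep hd
  rw [IndepFun_iff_Indep]
  refine indep_of_indep_of_le_left (indep_of_indep_of_le_right h ?_) hM.comap_le
  simp

theorem map_eq_of_isUniform {μ : Measure Ω} {U : Ω → ℝ}
    (hU : pdf.IsUniform U (Set.Icc 0 1) μ volume) :
    μ.map U = volume.restrict (Set.Icc (0 : ℝ) 1) := by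
  rw [hU, ProbabilityTheory.cond]
  simp

/-- Fubini for the product law of `(M, U)`; this replaces conditioning on the past. -/
theorem integral_comp_indepFun {μ : Measure Ω} [IsProbabilityMeasure μ] {M U : Ω → ℝ}
    (hM : Measurable M) (hU : Measurable U) (hunif : pdf.IsUniform U (Set.Icc 0 1) μ volume)
    (hind : IndepFun M U μ) {f : ℝ × ℝ → ℝ} (hf : Measurable f) {C : ℝ} (hC : ∀ p, ‖f p‖ ≤ C) :
    ∫ ω, f (M ω, U ω) ∂μ = ∫ ω, (∫ u in Set.Icc (0 : ℝ) 1, f (M ω, u)) ∂μ := by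
  have hprob : IsProbabilityMeasure (μ.map M) := Measure.isProbabilityMeasure_map hM.aemeasurable
  have hprod := (indepFun_iff_map_prod_eq_prod_map_map hM.aemeasurable hU.aemeasurable).1 hind
  rw [map_eq_of_isUniform hunif] at hprod
  have h1 : ∫ ω, f (M ω, U ω) ∂μ = ∫ p, f p ∂(μ.map fun ω => (M ω, U ω)) :=
    (integral_map (hM.prodMk hU).aemeasurable hf.aestronglyMeasurable).symm
  rw [h1, hprod, integral_prod _
    (Integrable.of_bound hf.aestronglyMeasurable C (Filter.Eventually.of_forall hC))]
  exact integral_map hM.aemeasurable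
    hf.stronglyMeasurable.integral_prod_right'.aestronglyMeasurable

theorem mem_Icc_of_isUniform {μ : Measure Ω} {U : Ω → ℝ} (hU : Measurable U)
    (hunif : pdf.IsUniform U (Set.Icc 0 1) μ volume) : ∀ᵐ ω ∂μ, U ω ∈ Set.Icc (0 : ℝ) 1 := by
  refine ae_of_ae_map hU.aemeasurable ?_
  rw [map_eq_of_isUniform hunif]
  exact ae_restrict_mem measurableSet_Icc

/-! ### Selection rules and the potential argument. -/

open Classical in
/-- The last value selected among the first `i` observations by the rule which selects `Y i` on
the event `S i`, and `0` if there is none. -/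
noncomputable def lastValue (S : ℕ → Ω → Prop) (Y : ℕ → Ω → ℝ) : ℕ → Ω → ℝ
  | 0, _ => 0
  | i + 1, ω => if S i ω then Y i ω else lastValue S Y i ω

open Classical in
/-- The number of selections among the first `i` observations. -/
noncomputable def selCount (S : ℕ → Ω → Prop) (i : ℕ) (ω : Ω) : ℕ :=
  Nat.count (fun k => S k ω) i

omit [MeasurableSpace Ω] in
theorem measurable_lastValue {X : Fin n → Ω → ℝ} {S : ℕ → Ω → Prop} {i : ℕ}
    (hS : ∀ k < i, MeasurableSet[past X (k + 1)] {ω | S k ω}) :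
    Measurable[past X i] (lastValue S (obs X) i) := by
  induction i with
  | zero => exact measurable_const
  | succ i ih =>
    exact Measurable.ite (hS i i.lt_succ_self) (measurable_obs X i)
      ((ih fun k hk => hS k (hk.trans i.lt_succ_self)).mono (past_mono X i.le_succ) le_rfl)

omit [MeasurableSpace Ω] in
theorem measurable_selCount {X : Fin n → Ω → ℝ} {S : ℕ → Ω → Prop} {i : ℕ}
    (hS : ∀ k < i, MeasurableSet[past X (k + 1)] {ω | S k ω}) :
    Measurable[past X i] (selCount S i) := by
  classical
  induction i with
  | zero =>
    have : selCount S 0 = fun _ => 0 := by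
      ext ω
      simp [selCount]
    rw [this]
    exact measurable_const
  | succ i ih =>
    have : selCount S (i + 1) = fun ω => selCount S i ω + if S i ω then 1 else 0 := by
      ext ω
      simp only [selCount, Nat.count_succ]
    rw [this]
    have h1 := (ih fun k hk => hS k (hk.trans i.lt_succ_self)).mono (past_mono X i.le_succ) le_rfl
    have h2 : Measurable[past X (i + 1)] fun ω => if S i ω then 1 else 0 :=
      Measurable.ite (hS i i.lt_succ_self) measurable_const measurable_const
    let _ := past X (i + 1)
    exact h1.add h2

/-- The number of selections among the first `i` observations plus the optimal expected number of
later selections. -/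
noncomputable def potential (X : Fin n → Ω → ℝ) (S : ℕ → Ω → Prop) (i : ℕ) (ω : Ω) : ℝ :=
  selCount S i ω + value (n - i) (lastValue S (obs X) i ω)

section

variable {μ : Measure Ω} [IsProbabilityMeasure μ] {X : Fin n → Ω → ℝ} {S : ℕ → Ω → Prop}

theorem integrable_selCount (hX : ∀ i, Measurable (X i))
    (hS : ∀ k < n, MeasurableSet[past X (k + 1)] {ω | S k ω}) {i : ℕ} (hi : i ≤ n) :
    Integrable (fun ω => (selCount S i ω : ℝ)) μ := by
  classical
  have hm : Measurable (selCount S i) :=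
    (measurable_selCount fun k hk => hS k (hk.trans_le hi)).mono (past_le hX i) le_rfl
  refine Integrable.of_bound (measurable_from_top.comp hm).aestronglyMeasurable (i : ℝ)
    (Filter.Eventually.of_forall fun ω => ?_)
  rw [Real.norm_of_nonneg (Nat.cast_nonneg _)]
  exact Nat.cast_le.2 (Nat.count_le _)

theorem measurable_lastValue' (hX : ∀ i, Measurable (X i))
    (hS : ∀ k < n, MeasurableSet[past X (k + 1)] {ω | S k ω}) {i : ℕ} (hi : i ≤ n) :
    Measurable (lastValue S (obs X) i) :=
  (measurable_lastValue fun k hk => hS k (hk.trans_le hi)).mono (past_le hX i) le_rfl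

theorem integrable_value_comp (k : ℕ) {M : Ω → ℝ} (hM : Measurable M) :
    Integrable (fun ω => value k (M ω)) μ := by
  refine Integrable.of_bound ((measurable_value k).comp hM).aestronglyMeasurable (k : ℝ)
    (Filter.Eventually.of_forall fun ω => ?_)
  rw [Real.norm_of_nonneg (value_nonneg k _)]
  exact value_le k _

theorem integrable_potential (hX : ∀ i, Measurable (X i))
    (hS : ∀ k < n, MeasurableSet[past X (k + 1)] {ω | S k ω}) {i : ℕ} (hi : i ≤ n) :
    Integrable (potential X S i) μ :=
  (integrable_selCount hX hS hi).add
    (integrable_value_comp _ (measurable_lastValue' hX hS hi))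

omit [MeasurableSpace Ω] in
theorem potential_succ {i : ℕ} (hi : i < n) (ω : Ω) [Decidable (S i ω)] :
    potential X S (i + 1) ω = selCount S i ω +
      if S i ω then 1 + value (n - (i + 1)) (X ⟨i, hi⟩ ω)
      else value (n - (i + 1)) (lastValue S (obs X) i ω) := by
  have hY : obs X i ω = X ⟨i, hi⟩ ω := by simp [obs, hi]
  by_cases h : S i ω
  · simp only [potential, selCount, Nat.count_succ, lastValue, h, if_true, hY]
    push_cast
    ring
  · simp [potential, selCount, Nat.count_succ, lastValue, h]

/-- The integrand `f` is left free so that the same identity serves the recursion with `≤` (upper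
bound) and the one with `<` (optimal rule). -/
theorem integral_potential_eq (hX : ∀ i, Measurable (X i))
    (hunif : ∀ i, pdf.IsUniform (X i) (Set.Icc 0 1) μ volume) (hindep : iIndepFun X μ)
    (hS : ∀ k < n, MeasurableSet[past X (k + 1)] {ω | S k ω}) {i : ℕ} (hi : i < n)
    {f : ℝ × ℝ → ℝ} (hf : Measurable f) {C : ℝ} (hC : ∀ p, ‖f p‖ ≤ C)
    (hfv : ∀ x, value (n - i) x = ∫ u in Set.Icc (0 : ℝ) 1, f (x, u)) :
    ∫ ω, potential X S i ω ∂μ =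
      ∫ ω, (selCount S i ω + f (lastValue S (obs X) i ω, X ⟨i, hi⟩ ω)) ∂μ := by
  have hM := measurable_lastValue' hX hS hi.le
  have hind : IndepFun (lastValue S (obs X) i) (X ⟨i, hi⟩) μ :=
    indepFun_of_past hX hindep ⟨i, hi⟩ (measurable_lastValue fun k hk => hS k (hk.trans hi))
  have hint : Integrable (fun ω => f (lastValue S (obs X) i ω, X ⟨i, hi⟩ ω)) μ :=
    Integrable.of_bound (hf.comp (hM.prodMk (hX _))).aestronglyMeasurable C
      (Filter.Eventually.of_forall fun ω => hC _)
  unfold potential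
  rw [integral_add (integrable_selCount hX hS hi.le) (integrable_value_comp _ hM),
    integral_add (integrable_selCount hX hS hi.le) hint,
    integral_comp_indepFun hM (hX _) (hunif _) hind hf hC]
  simp_rw [hfv]

theorem integral_potential_zero : ∫ ω, potential X S 0 ω ∂μ = value n 0 := by
  simp [potential, selCount, lastValue]

omit [IsProbabilityMeasure μ] in
theorem integral_potential_last :
    ∫ ω, potential X S n ω ∂μ = ∫ ω, (selCount S n ω : ℝ) ∂μ := by
  simp [potential, value]

theorem norm_max_value_le (k : ℕ) (p : Prop) [Decidable p] (x u : ℝ) :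
    ‖if p then max (value k x) (1 + value k u) else value k x‖ ≤ k + 1 := by
  have h1 := value_nonneg k x
  have h2 := value_le k x
  have h3 := value_le k u
  split_ifs
  · rw [Real.norm_of_nonneg (le_max_of_le_left h1)]
    exact max_le (by linarith) (by linarith)
  · rw [Real.norm_of_nonneg h1]
    linarith

/-- No rule that selects increasing values makes more than `value n 0` selections on average. -/
theorem integral_selCount_le_value (hX : ∀ i, Measurable (X i))
    (hunif : ∀ i, pdf.IsUniform (X i) (Set.Icc 0 1) μ volume) (hindep : iIndepFun X μ)
    (hS : ∀ k < n, MeasurableSet[past X (k + 1)] {ω | S k ω})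
    (hle : ∀ᵐ ω ∂μ, ∀ i (hi : i < n), S i ω → lastValue S (obs X) i ω ≤ X ⟨i, hi⟩ ω) :
    ∫ ω, (selCount S n ω : ℝ) ∂μ ≤ value n 0 := by
  classical
  have key : ∀ i ≤ n, ∫ ω, potential X S i ω ∂μ ≤ value n 0 := by
    intro i
    induction i with
    | zero => exact fun _ => integral_potential_zero.le
    | succ i ih =>
      intro hi
      have hi' : i < n := hi
      refine le_trans ?_ (ih hi'.le)
      have hk : n - i = n - (i + 1) + 1 := by omega
      set k := n - (i + 1) with hkdef
      have hf : Measurable fun p : ℝ × ℝ =>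
          if p.1 ≤ p.2 then max (value k p.1) (1 + value k p.2) else value k p.1 :=
        Measurable.ite (measurableSet_le measurable_fst measurable_snd)
          (((measurable_value k).comp measurable_fst).max
            (((measurable_value k).comp measurable_snd).const_add 1))
          ((measurable_value k).comp measurable_fst)
      have hC := fun p : ℝ × ℝ => norm_max_value_le k (p.1 ≤ p.2) p.1 p.2
      rw [integral_potential_eq hX hunif hindep hS hi' hf hC
        fun x => by rw [hk]; exact value_succ_eq_integral_le k x]
      refine integral_mono_ae (integrable_potential hX hS hi)
        ((integrable_selCount hX hS hi'.le).add
          (Integrable.of_bound (hf.comp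
            ((measurable_lastValue' hX hS hi'.le).prodMk (hX _))).aestronglyMeasurable _
            (Filter.Eventually.of_forall fun ω => hC _))) ?_
      filter_upwards [hle] with ω hω
      rw [potential_succ hi', ← hkdef]
      refine add_le_add le_rfl ?_
      by_cases h : S i ω
      · rw [if_pos h, if_pos (hω i hi' h)]
        exact le_max_right _ _
      · rw [if_neg h]
        split_ifs
        · exact le_max_left _ _
        · exact le_rfl
  rw [← integral_potential_last (X := X)]
  exact key n le_rfl

/-- The rule that selects whenever this does not decrease the optimal expected total makes
`value n 0` selections on average. -/
theorem integral_selCount_eq_value (hX : ∀ i, Measurable (X i))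
    (hunif : ∀ i, pdf.IsUniform (X i) (Set.Icc 0 1) μ volume) (hindep : iIndepFun X μ)
    (hS : ∀ k < n, MeasurableSet[past X (k + 1)] {ω | S k ω})
    (hiff : ∀ ω i (hi : i < n), S i ω ↔ lastValue S (obs X) i ω < X ⟨i, hi⟩ ω ∧
      value (n - (i + 1)) (lastValue S (obs X) i ω) ≤ 1 + value (n - (i + 1)) (X ⟨i, hi⟩ ω)) :
    ∫ ω, (selCount S n ω : ℝ) ∂μ = value n 0 := by
  classical
  have key : ∀ i ≤ n, ∫ ω, potential X S i ω ∂μ = value n 0 := by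
    intro i
    induction i with
    | zero => exact fun _ => integral_potential_zero
    | succ i ih =>
      intro hi
      have hi' : i < n := hi
      have hk : n - i = n - (i + 1) + 1 := by omega
      rw [← ih hi'.le, integral_potential_eq hX hunif hindep hS hi'
        (measurable_stepReward (measurable_value (n - (i + 1))))
        (fun p => norm_max_value_le _ (p.1 < p.2) p.1 p.2) fun x => by rw [hk]; rfl]
      refine integral_congr_ae (Filter.Eventually.of_forall fun ω => ?_)
      dsimp only
      rw [potential_succ hi']
      -- The acceptance test is exactly the condition under which the second entry of the maximum is
      -- available and at least the first.
      simp only [hiff ω i hi', stepReward]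
      grind
  rw [← integral_potential_last (X := X)]
  exact key n le_rfl

end

omit [MeasurableSpace Ω] in
theorem lastValue_eq_of_not {S : ℕ → Ω → Prop} {Y : ℕ → Ω → ℝ} {ω : Ω} {a b : ℕ} (hab : a < b)
    (ha : S a ω) (hb : ∀ k, a < k → k < b → ¬ S k ω) : lastValue S Y b ω = Y a ω := by
  classical
  induction b, hab using Nat.le_induction with
  | base => simp [lastValue, ha]
  | succ b hab ih =>
    rw [lastValue, if_neg (hb b hab b.lt_succ_self)]
    exact ih fun k hk hkb => hb k hk (hkb.trans b.lt_succ_self)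

omit [MeasurableSpace Ω] in
theorem lastValue_eq_zero {S : ℕ → Ω → Prop} {Y : ℕ → Ω → ℝ} {ω : Ω} {b : ℕ}
    (hb : ∀ k < b, ¬ S k ω) : lastValue S Y b ω = 0 := by
  classical
  induction b with
  | zero => rfl
  | succ b ih =>
    rw [lastValue, if_neg (hb b b.lt_succ_self)]
    exact ih fun k hk => hb k (hk.trans b.lt_succ_self)

/-! ### From policies to rules: the upper bound. -/

namespace SelectionPolicy

variable {X : Fin n → Ω → ℝ} {hX : ∀ i, Measurable (X i)}

/-- The policy `π` selects the observation with index `i`. -/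
def Selects (π : SelectionPolicy X hX) (i : ℕ) (ω : Ω) : Prop :=
  ∃ h : i < n, ∃ j, π.τ j ω = (⟨i, h⟩ : Fin n)

theorem measurableSet_selects (π : SelectionPolicy X hX) {i : ℕ} (hi : i < n) :
    MeasurableSet[past X (i + 1)] {ω | π.Selects i ω} := by
  have : {ω | π.Selects i ω} = ⋃ j, {ω | π.τ j ω = (⟨i, hi⟩ : Fin n)} := by
    ext ω
    simp [Selects, hi]
  rw [this]
  refine MeasurableSet.iUnion fun j => ?_
  have := (π.isStoppingTime j).measurableSet_eq (⟨i, hi⟩ : Fin n)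
  rwa [natural_eq_past hX] at this

/-- Only an inequality, since the length stops counting at the first tie. -/
theorem length_le_selCount (π : SelectionPolicy X hX) (ω : Ω) :
    π.length ω ≤ selCount π.Selects n ω := by
  classical
  obtain ⟨i, hi, hmono, -⟩ := (π.isGreatest_length ω).1
  rw [selCount, Nat.count_eq_card_filter_range]
  calc π.length ω = (Finset.univ.image fun j => (i j : ℕ)).card := by
        refine Eq.symm ((Finset.card_image_of_injective _ ?_).trans (by simp))
        exact Fin.val_injective.comp hmono.injective
    _ ≤ _ := by
        refine Finset.card_le_card fun k hk => ?_
        obtain ⟨j, -, rfl⟩ := Finset.mem_image.1 hk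
        simp only [Finset.mem_filter, Finset.mem_range]
        exact ⟨(i j).2, (i j).2, j, hi j⟩

theorem lt_of_lt (π : SelectionPolicy X hX) {ω : Ω} {j k : ℕ} (hjk : j < k)
    (h : π.τ j ω ≠ ⊤) : π.τ j ω < π.τ k ω := by
  induction k, hjk using Nat.le_induction with
  | base => exact π.lt_succ j ω h
  | succ k _ ih =>
    by_cases hk : π.τ k ω = ⊤
    · rw [π.succ_eq_top k ω hk, ← hk]
      exact ih
    · exact ih.trans (π.lt_succ k ω hk)

/-- Nothing is selected strictly between consecutive selection times, so `lastValue` is the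
previously selected value. Before the first selection it is the default `0`, whence the
nonnegativity assumption. -/
theorem lastValue_selects_le (π : SelectionPolicy X hX) {ω : Ω} (hω : ∀ i, 0 ≤ X i ω) {i : ℕ}
    (hi : i < n) (hs : π.Selects i ω) : lastValue π.Selects (obs X) i ω ≤ X ⟨i, hi⟩ ω := by
  obtain ⟨_, j, hj⟩ := hs
  cases j with
  | zero =>
    rw [lastValue_eq_zero fun k hk => ?_]
    · exact hω _
    · rintro ⟨hkn, m, hm⟩
      rcases Nat.eq_zero_or_pos m with rfl | hm0
      · rw [hj, WithTop.coe_inj, Fin.mk.injEq] at hm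
        omega
      · have := π.lt_of_lt hm0 (by rw [hj]; exact WithTop.coe_ne_top)
        rw [hj, hm, WithTop.coe_lt_coe, Fin.mk_lt_mk] at this
        omega
  | succ j =>
    have htop : π.τ j ω ≠ ⊤ := fun h => by
      have := π.succ_eq_top j ω h
      rw [hj] at this
      exact WithTop.coe_ne_top this
    obtain ⟨a, ha⟩ := WithTop.ne_top_iff_exists.1 htop
    have hai := π.lt_succ j ω htop
    rw [hj, ← ha, WithTop.coe_lt_coe] at hai
    have hlast : lastValue π.Selects (obs X) i ω = obs X a ω := by
      refine lastValue_eq_of_not hai ⟨a.2, j, ha.symm⟩ fun k hak hki => ?_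
      rintro ⟨hkn, m, hm⟩
      rcases lt_trichotomy m j with hmj | rfl | hmj
      · have := π.lt_of_lt hmj (by rw [hm]; exact WithTop.coe_ne_top)
        rw [hm, ← ha, WithTop.coe_lt_coe, Fin.lt_def] at this
        exact absurd this (by simpa using hak.le)
      · rw [← ha, WithTop.coe_inj] at hm
        rw [hm] at hak
        simp at hak
      · rcases Nat.eq_or_lt_of_le (Nat.succ_le_of_lt hmj) with rfl | hmj'
        · rw [hj, WithTop.coe_inj, Fin.mk.injEq] at hm
          omega
        · have := π.lt_of_lt hmj' (by rw [hj]; exact WithTop.coe_ne_top)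
          rw [Nat.succ_eq_add_one, hj, hm, WithTop.coe_lt_coe, Fin.mk_lt_mk] at this
          omega
    rw [hlast]
    have := π.le_succ j ω a ⟨i, hi⟩ ha.symm hj
    simpa [obs] using this

theorem expectedLength_le_value (π : SelectionPolicy X hX) {μ : Measure Ω}
    [IsProbabilityMeasure μ] (hunif : ∀ i, pdf.IsUniform (X i) (Set.Icc 0 1) μ volume)
    (hindep : iIndepFun X μ) : π.expectedLength μ ≤ value n 0 := by
  have hS : ∀ k < n, MeasurableSet[past X (k + 1)] {ω | π.Selects k ω} :=
    fun k hk => π.measurableSet_selects hk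
  refine le_trans (integral_mono (π.integrable_length μ) (integrable_selCount hX hS le_rfl)
    fun ω => Nat.cast_le.2 (π.length_le_selCount ω)) ?_
  refine integral_selCount_le_value hX hunif hindep hS ?_
  filter_upwards [ae_all_iff.2 fun i => mem_Icc_of_isUniform (hX i) (hunif i)] with ω hω i hi hs
  exact π.lastValue_selects_le (fun i => (hω i).1) hi hs

/-! ### From rules to policies. -/

open Classical in
/-- The `j`-th selection time of the rule that selects the observation `i` on the event `S i`. -/
noncomputable def ruleTime (n : ℕ) (S : ℕ → Ω → Prop) (j : ℕ) (ω : Ω) : WithTop (Fin n) :=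
  if h : ∃ i : Fin n, S i ω ∧ selCount S i ω = j then (h.choose : Fin n) else ⊤

omit [MeasurableSpace Ω] in
theorem ruleTime_eq_iff {S : ℕ → Ω → Prop} {j : ℕ} {ω : Ω} {a : Fin n} :
    ruleTime n S j ω = a ↔ S a ω ∧ selCount S a ω = j := by
  classical
  constructor
  · intro h
    unfold ruleTime at h
    split_ifs at h with h'
    · rw [WithTop.coe_inj] at h
      rw [← h]
      exact h'.choose_spec
    · exact absurd h.symm WithTop.coe_ne_top
  · intro h
    have h' : ∃ i : Fin n, S i ω ∧ selCount S i ω = j := ⟨a, h⟩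
    rw [ruleTime, dif_pos h', WithTop.coe_inj]
    -- Distinct selected indices have distinct numbers of earlier selections, so the chosen index is
    -- the only candidate.
    exact Fin.ext (Nat.count_injective h'.choose_spec.1 h.1 (h'.choose_spec.2.trans h.2.symm))

omit [MeasurableSpace Ω] in
theorem exists_of_ruleTime_ne_top {S : ℕ → Ω → Prop} {j : ℕ} {ω : Ω}
    (h : ruleTime n S j ω ≠ ⊤) : ∃ a : Fin n, ruleTime n S j ω = a ∧ S a ω ∧
      selCount S a ω = j := by
  obtain ⟨a, ha⟩ := WithTop.ne_top_iff_exists.1 h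
  exact ⟨a, ha.symm, ruleTime_eq_iff.1 ha.symm⟩

omit [MeasurableSpace Ω] in
-- The count rises by at most one at a time, so it skips no level.
theorem exists_selCount_eq {S : ℕ → Ω → Prop} {ω : Ω} {b j : ℕ} (h : j < selCount S b ω) :
    ∃ a < b, S a ω ∧ selCount S a ω = j := by
  classical
  induction b with
  | zero => simp [selCount] at h
  | succ b ih =>
    by_cases hj : j < selCount S b ω
    · obtain ⟨a, hab, ha⟩ := ih hj
      exact ⟨a, hab.trans b.lt_succ_self, ha⟩
    · have hb : selCount S (b + 1) ω = selCount S b ω + if S b ω then 1 else 0 :=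
        Nat.count_succ _ _
      split_ifs at hb with hS
      · exact ⟨b, b.lt_succ_self, hS, by omega⟩
      · omega

omit [MeasurableSpace Ω] in
/-- Consecutive selections of a rule that selects increasing values are increasing. -/
theorem lt_of_selCount_succ {S : ℕ → Ω → Prop}
    (hlt : ∀ ω i (hi : i < n), S i ω → lastValue S (obs X) i ω < X ⟨i, hi⟩ ω) {ω : Ω} {j : ℕ}
    {a b : Fin n} (ha : S a ω ∧ selCount S a ω = j) (hb : S b ω ∧ selCount S b ω = j + 1) :
    X a ω < X b ω := by
  classical
  have hab : (a : ℕ) < b := by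
    refine Nat.lt_of_count_lt_count (p := fun k => S k ω) ?_
    have h1 := ha.2
    have h2 := hb.2
    unfold selCount at h1 h2
    omega
  have h := hlt ω b b.2 hb.1
  rw [lastValue_eq_of_not hab ha.1 fun k hak hkb hk => ?_] at h
  · simpa [obs] using h
  · have h1 := Nat.count_strict_mono (p := fun k => S k ω) ha.1 hak
    have h2 := Nat.count_strict_mono (p := fun k => S k ω) hk hkb
    have h3 := ha.2
    have h4 := hb.2
    unfold selCount at h3 h4
    omega

/-- The policy given by a rule that selects increasing values. -/
noncomputable def ofRule (hX : ∀ i, Measurable (X i)) (S : ℕ → Ω → Prop)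
    (hS : ∀ k < n, MeasurableSet[past X (k + 1)] {ω | S k ω})
    (hlt : ∀ ω i (hi : i < n), S i ω → lastValue S (obs X) i ω < X ⟨i, hi⟩ ω) :
    SelectionPolicy X hX where
  τ := ruleTime n S
  isStoppingTime j := by
    refine isStoppingTime_of_measurableSet_eq fun i => ?_
    rw [natural_eq_past hX]
    have : {ω | ruleTime n S j ω = i} = {ω | S i ω} ∩ selCount S i ⁻¹' {j} := by
      ext ω
      simp [ruleTime_eq_iff]
    rw [this]
    exact (hS i i.2).inter (past_mono X (Nat.le_succ i) _
      (measurable_selCount (fun k hk => hS k (hk.trans i.2)) (measurableSet_singleton j)))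
  lt_succ j ω h := by
    classical
    obtain ⟨a, ha, haS, haj⟩ := exists_of_ruleTime_ne_top h
    by_cases h' : ruleTime n S (j + 1) ω = ⊤
    · rw [h', ha]
      exact WithTop.coe_lt_top a
    · obtain ⟨b, hb, hbS, hbj⟩ := exists_of_ruleTime_ne_top h'
      rw [ha, hb, WithTop.coe_lt_coe]
      refine Nat.lt_of_count_lt_count (p := fun k => S k ω) ?_
      unfold selCount at haj hbj
      omega
  succ_eq_top j ω h := by
    by_contra h'
    obtain ⟨b, -, -, hbj⟩ := exists_of_ruleTime_ne_top h'
    obtain ⟨a, hab, ha⟩ := exists_selCount_eq (S := S) (ω := ω) (b := b) (j := j) (by omega)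
    have := (ruleTime_eq_iff (a := ⟨a, hab.trans b.2⟩)).2 ha
    rw [h] at this
    exact WithTop.coe_ne_top this.symm
  le_succ j ω a b ha hb :=
    (lt_of_selCount_succ hlt (ruleTime_eq_iff.1 ha) (ruleTime_eq_iff.1 hb)).le

theorem selCount_le_length_ofRule (hX : ∀ i, Measurable (X i)) {S : ℕ → Ω → Prop}
    (hS : ∀ k < n, MeasurableSet[past X (k + 1)] {ω | S k ω})
    (hlt : ∀ ω i (hi : i < n), S i ω → lastValue S (obs X) i ω < X ⟨i, hi⟩ ω) (ω : Ω) :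
    selCount S n ω ≤ (ofRule hX S hS hlt).length ω := by
  refine ((ofRule hX S hS hlt).isGreatest_length ω).2 ?_
  have hex : ∀ j : Fin (selCount S n ω), ∃ a : Fin n, S a ω ∧ selCount S a ω = j := fun j => by
    obtain ⟨a, han, ha⟩ := exists_selCount_eq j.2
    exact ⟨⟨a, han⟩, ha⟩
  choose i hi using hex
  refine ⟨i, fun j => ruleTime_eq_iff.2 (hi j), ?_, ?_⟩
  · classical
    intro j k hjk
    refine Nat.lt_of_count_lt_count (p := fun k => S k ω) ?_
    have h1 := (hi j).2
    have h2 := (hi k).2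
    unfold selCount at h1 h2
    rw [Fin.lt_def] at hjk
    omega
  -- Only consecutive selections are known to increase; induction on the gap covers all pairs.
  · have key : ∀ d (j k : Fin (selCount S n ω)), (k : ℕ) = j + d + 1 →
        X (i j) ω < X (i k) ω := by
      intro d
      induction d with
      | zero =>
        intro j k hjk
        exact lt_of_selCount_succ hlt (hi j) (by simpa [hjk] using hi k)
      | succ d ih =>
        intro j k hjk
        have hl : (j : ℕ) + d + 1 < selCount S n ω := by omega
        exact (ih j ⟨j + d + 1, hl⟩ rfl).trans
          (lt_of_selCount_succ hlt (hi ⟨j + d + 1, hl⟩) ⟨(hi k).1, (hi k).2.trans hjk⟩)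
    intro j k hjk
    rw [Fin.lt_def] at hjk
    exact key (k - j - 1) j k (by omega)

end SelectionPolicy

/-! ### The optimal rule. -/

/-- The observation `u` with index `i` should be selected when the last selected value is `m`. -/
def Accepts (n i : ℕ) (m u : ℝ) : Prop :=
  m < u ∧ value (n - (i + 1)) m ≤ 1 + value (n - (i + 1)) u

open Classical in
/-- The last value selected among the first `i` observations by the optimal rule. -/
noncomputable def optimalLastValue (X : Fin n → Ω → ℝ) : ℕ → Ω → ℝ
  | 0, _ => 0
  | i + 1, ω =>
    if Accepts n i (optimalLastValue X i ω) (obs X i ω) then obs X i ω else optimalLastValue X i ω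

/-- The optimal rule selects the observation with index `i`. -/
def OptimalSelects (X : Fin n → Ω → ℝ) (i : ℕ) (ω : Ω) : Prop :=
  Accepts n i (optimalLastValue X i ω) (obs X i ω)

-- The rule depends on the last selected value, which depends on the rule. A separate recursion for
-- that value breaks the circle, and this identity reconciles it with `lastValue`.
omit [MeasurableSpace Ω] in
theorem lastValue_optimalSelects (X : Fin n → Ω → ℝ) (i : ℕ) (ω : Ω) :
    lastValue (OptimalSelects X) (obs X) i ω = optimalLastValue X i ω := by
  induction i with
  | zero => rfl
  | succ i ih =>
    rw [lastValue, optimalLastValue, ih]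
    rfl

omit [MeasurableSpace Ω] in
theorem optimalSelects_iff (X : Fin n → Ω → ℝ) (ω : Ω) (i : ℕ) (hi : i < n) :
    OptimalSelects X i ω ↔ lastValue (OptimalSelects X) (obs X) i ω < X ⟨i, hi⟩ ω ∧
      value (n - (i + 1)) (lastValue (OptimalSelects X) (obs X) i ω) ≤
        1 + value (n - (i + 1)) (X ⟨i, hi⟩ ω) := by
  have hY : obs X i ω = X ⟨i, hi⟩ ω := by simp [obs, hi]
  rw [lastValue_optimalSelects, OptimalSelects, Accepts, hY]

omit [MeasurableSpace Ω] in
theorem measurableSet_optimalSelects (X : Fin n → Ω → ℝ) (i : ℕ) :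
    MeasurableSet[past X (i + 1)] {ω | OptimalSelects X i ω} := by
  induction i using Nat.strong_induction_on with
  | _ i ih =>
    have h1 : Measurable[past X (i + 1)] (lastValue (OptimalSelects X) (obs X) i) :=
      (measurable_lastValue ih).mono (past_mono X i.le_succ) le_rfl
    have h2 := measurable_obs X i
    have hv := measurable_value (n - (i + 1))
    have : {ω | OptimalSelects X i ω} =
        {ω | lastValue (OptimalSelects X) (obs X) i ω < obs X i ω} ∩
          {ω | value (n - (i + 1)) (lastValue (OptimalSelects X) (obs X) i ω) ≤
            1 + value (n - (i + 1)) (obs X i ω)} := by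
      ext ω
      simp only [lastValue_optimalSelects]
      rfl
    rw [this]
    let _ := past X (i + 1)
    exact (measurableSet_lt h1 h2).inter
      (measurableSet_le (hv.comp h1) ((hv.comp h2).const_add 1))

theorem exists_expectedLength_eq_value {μ : Measure Ω} [IsProbabilityMeasure μ]
    {X : Fin n → Ω → ℝ} (hX : ∀ i, Measurable (X i))
    (hunif : ∀ i, pdf.IsUniform (X i) (Set.Icc 0 1) μ volume) (hindep : iIndepFun X μ) :
    ∃ π : SelectionPolicy X hX, π.expectedLength μ = value n 0 := by
  have hS : ∀ k < n, MeasurableSet[past X (k + 1)] {ω | OptimalSelects X k ω} :=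
    fun k _ => measurableSet_optimalSelects X k
  have hlt := fun ω i (hi : i < n) h => ((optimalSelects_iff X ω i hi).1 h).1
  -- The rule selects strictly increasing values, so its length is at least its count, of mean
  -- `value n 0`; the general upper bound gives the converse.
  refine ⟨SelectionPolicy.ofRule hX _ hS hlt, le_antisymm
    (SelectionPolicy.expectedLength_le_value _ hunif hindep) ?_⟩
  rw [← integral_selCount_eq_value hX hunif hindep hS (optimalSelects_iff X)]
  exact integral_mono (integrable_selCount hX hS le_rfl)
    (SelectionPolicy.integrable_length _ μ)
    fun ω => Nat.cast_le.2 (SelectionPolicy.selCount_le_length_ofRule hX hS hlt ω)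

end OnlineSelection

/-- For `n ≥ 1` independent observations, uniform on `[0, 1]`, the maximal expected length `ℓ(n)` of
an increasing subsequence selected online is attained by some policy and is at most `√(2n)`. -/
theorem mainTheorem3 {Ω : Type*} [MeasurableSpace Ω] (μ : Measure Ω) [IsProbabilityMeasure μ]
    (n : ℕ) (hn : 1 ≤ n) (X : Fin n → Ω → ℝ) (hX : ∀ i, Measurable (X i))
    (hunif : ∀ i, pdf.IsUniform (X i) (Set.Icc 0 1) μ volume) (hindep : iIndepFun X μ) :
    IsGreatest
        (Set.range fun π : OnlineSelection.SelectionPolicy X hX => π.expectedLength μ)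
        (OnlineSelection.optimalLength μ X hX) ∧
      OnlineSelection.optimalLength μ X hX ≤ √(2 * (n : ℝ)) := by
  obtain ⟨π, hπ⟩ := OnlineSelection.exists_expectedLength_eq_value hX hunif hindep
  have hg : IsGreatest
      (Set.range fun π : OnlineSelection.SelectionPolicy X hX => π.expectedLength μ)
      (OnlineSelection.value n 0) := by
    refine ⟨⟨π, hπ⟩, ?_⟩
    rintro _ ⟨π', rfl⟩
    exact π'.expectedLength_le_value hunif hindep
  have heq : OnlineSelection.optimalLength μ X hX = OnlineSelection.value n 0 := hg.csSup_eq
  rw [heq]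
  exact ⟨hg, OnlineSelection.value_zero_le_sqrt hn⟩
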